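/- Let $N\ge 1$, let $C_h\in\mathbb{R}^{N\times N}$ be symmetric positive definite, let $h\sim\mathcal N(0,C_h)$ be an $\mathbb{R}^N$-valued Gaussian random vector, and let $r=\operatorname{sign}(h)$ be its element-wise sign. For a vector $\rho$ put $\overline Q(\rho)=\{x:\operatorname{sign}(x)=\rho\}$, write $\rho^n$ for $\rho$ with its $n$-th entry removed, and let $\mathcal N(x;\mu,C)$ denote the Gaussian density with mean $\mu$ and covariance matrix $C$. For $1\le n\le N$ let $\mathcal N^n(x;0,C_h)$ be the $(N-1)$-dimensional zero-mean Gaussian density whose inverse covariance matrix is $C_h^{-1}$ with the $n$-th row and column deleted (for $N=1$ the integral below is $1$). Then $r\in\{-1,1\}^N$ almost surely, $h$ is integrable, and for every $\rho\in\{-1,1\}^N$ the probability $p_r(\rho)=\mathbb P(r=\rho)$ is positive and equals the Gaussian orthant integral $\int_{\overline Q(\rho)}\mathcal N(x;0,C_h)\,dx$, and the conditional mean of $h$ given $r=\rho$ has the entries $$\big[\mathbb E[h\mid r=\rho]\big]_i=\frac{1}{p_r(\rho)}\sum_{n=1}^N \rho_n\,[C_h]_{i,n}\,\mathcal N(0;0,[C_h]_{n,n})\int_{\overline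 Q(\rho^n)}\mathcal N^n(x;0,C_h)\,dx,\qquad i=1,\dots,N.$$ Equivalently, the conditional expectation $\mathbb E[h\mid r]$ given the $\sigma$-algebra generated by $r$ is almost surely this expression evaluated at $\rho=r$. -/

import Mathlib

open MeasureTheory ProbabilityTheory Matrix

namespace OneBit

noncomputable section

/-- The Gaussian density `𝒩(x; μ, C)` on `ℝ^ι`, for a positive definite covariance matrix `C`. -/
def gaussianDensity {ι : Type*} [Fintype ι] [DecidableEq ι]
    (μ : ι → ℝ) (C : Matrix ι ι ℝ) (x : ι → ℝ) : ℝ :=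
  (Real.sqrt ((2 * Real.pi) ^ Fintype.card ι * C.det))⁻¹ *
    Real.exp (-((x - μ) ⬝ᵥ (C⁻¹ *ᵥ (x - μ))) / 2)

/-- The noiseless one-bit quantizer: the element-wise sign. -/
def quantize {ι : Type*} (x : ι → ℝ) : ι → ℝ := fun j => Real.sign (x j)

/-- The set of all real vectors that are quantized to `r`. -/
def quantCell {ι : Type*} (r : ι → ℝ) : Set (ι → ℝ) := {x | quantize x = r}

/-- The vector `r` with its `n`-th entry removed. -/
def truncVec {ι : Type*} (n : ι) (r : ι → ℝ) : {j : ι // j ≠ n} → ℝ := fun j => r j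

/-- The matrix `A` with its `n`-th row and `n`-th column deleted. -/
def truncMat {ι : Type*} (n : ι) (A : Matrix ι ι ℝ) :
    Matrix {j : ι // j ≠ n} {j : ι // j ≠ n} ℝ :=
  A.submatrix (fun j => (j : ι)) (fun j => (j : ι))

/-- The density `𝒩ⁿ(x; 0, C)` of the centred Gaussian with one dimension less whose precision
matrix (inverse covariance matrix) is `C⁻¹` with the `n`-th row and column deleted. -/
def truncGaussianDensity {ι : Type*} [Fintype ι] [DecidableEq ι] (n : ι)
    (C : Matrix ι ι ℝ) (x : {j : ι // j ≠ n} → ℝ) : ℝ :=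
  gaussianDensity 0 (truncMat n C⁻¹)⁻¹ x

/-- The sum `∑ₙ rₙ C_{i,n} 𝒩(0; 0, C_{n,n}) ∫ 𝒩ⁿ(x; 0, C) dx`, each integral being over the
orthant of the truncated sign vector. -/
def orthantSum {ι : Type*} [Fintype ι] [DecidableEq ι]
    (C : Matrix ι ι ℝ) (r : ι → ℝ) (i : ι) : ℝ :=
  ∑ n, r n * C i n * gaussianPDFReal 0 (C n n).toNNReal 0 *
    ∫ x in quantCell (truncVec n r), truncGaussianDensity n C x

/-- The observation `sign(h)`, as a random vector. -/
def observation {Ω : Type*} {N : ℕ} (h : Ω → EuclideanSpace ℝ (Fin N)) (ω : Ω) : Fin N → ℝ :=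
  quantize (fun j => h ω j)

/-- The probability mass function of the observation. -/
def obsPMF {Ω : Type*} [MeasurableSpace Ω] (P : Measure Ω) {N : ℕ}
    (h : Ω → EuclideanSpace ℝ (Fin N)) (r : Fin N → ℝ) : ℝ :=
  P.real (observation h ⁻¹' {r})

/-- The conditional mean of `h` given the observed value `r`: the mean of `h` under the conditional
probability given the event `sign(h) = r`. -/
def conditionalMean {Ω : Type*} [MeasurableSpace Ω] (P : Measure Ω) {N : ℕ}
    (h : Ω → EuclideanSpace ℝ (Fin N)) (r : Fin N → ℝ) : EuclideanSpace ℝ (Fin N) :=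
  ∫ ω, h ω ∂(ProbabilityTheory.cond P (observation h ⁻¹' {r}))

end

end OneBit

/-!
The conditional mean given `sign(h) = r` is the integral of `x` against the Gaussian density `p`
over the orthant `quantCell r`, divided by the probability of the orthant. The integral is computed by
integration by parts. Since `∂ₙ p(x) = -(C⁻¹ x)ₙ p(x)`
(`hasDerivAt_gaussianDensity_insertEntry`), the identity `x = C (C⁻¹ x)` expresses
`xᵢ p(x)` as `-∑ₙ C i n ∂ₙ p(x)`. The integral of `∂ₙ p` over the orthant is `-r n` times the
integral of `p` over the face `x n = 0` (`setIntegral_quantCell_of_hasDerivAt`: Fubini and the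
fundamental theorem of calculus on a half-line). On that face, `p` is the product of
`𝒩(0; 0, C n n)` and the Gaussian density with the truncated precision matrix
(`gaussianDensity_insertEntry_zero`), since `det (truncMat n C⁻¹) = C n n / det C`.

Two bridges connect this computation with the probabilistic notions.
`map_ofLp_multivariateGaussian` shows that Mathlib's `multivariateGaussian 0 C`, the image of a
standard Gaussian measure under the square root of `C`, has the density `gaussianDensity 0 C`.
`condExp_comap_eq_average` identifies the conditional expectation given an observation with the
average over the corresponding fibre when that fibre has positive probability, as all orthants do.
Almost surely no coordinate of `h` is zero, so that `h` lies in one of them.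
-/

namespace OneBit

/-! ### The Lebesgue density of the multivariate Gaussian measure -/

/-- The standard Gaussian product measure on `ℝ^ι` has the product of the one-dimensional densities
as its Lebesgue density. -/
lemma pi_gaussianReal_eq_withDensity (ι : Type*) [Fintype ι] :
    Measure.pi (fun _ : ι => gaussianReal 0 1) =
      (volume : Measure (ι → ℝ)).withDensity
        (fun x => ENNReal.ofReal (∏ i, gaussianPDFReal 0 1 (x i))) := by
  refine Measure.pi_eq fun s hs => ?_
  have hind : ∀ i, Integrable ((s i).indicator (gaussianPDFReal 0 1)) :=
    fun i => (integrable_gaussianPDFReal 0 1).indicator (hs i)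
  have hnn : ∀ i t, 0 ≤ (s i).indicator (gaussianPDFReal 0 1) t := fun i t =>
    Set.indicator_nonneg (fun t _ => gaussianPDFReal_nonneg 0 1 t) t
  rw [withDensity_apply _ (MeasurableSet.univ_pi hs),
    ← lintegral_indicator (MeasurableSet.univ_pi hs)]
  have hprod : ∀ x : ι → ℝ, (Set.univ.pi s).indicator
      (fun x => ENNReal.ofReal (∏ i, gaussianPDFReal 0 1 (x i))) x =
      ENNReal.ofReal (∏ i, (s i).indicator (gaussianPDFReal 0 1) (x i)) := by
    intro x
    by_cases hx : x ∈ Set.univ.pi s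
    · rw [Set.indicator_of_mem hx]
      congr 1
      exact Finset.prod_congr rfl fun i _ => (Set.indicator_of_mem (hx i trivial) _).symm
    · rw [Set.indicator_of_notMem hx]
      obtain ⟨i, hi⟩ : ∃ i, x i ∉ s i := by simpa [Set.mem_pi] using hx
      rw [Finset.prod_eq_zero (Finset.mem_univ i) (Set.indicator_of_notMem hi _)]
      simp
  simp_rw [hprod]
  rw [← ofReal_integral_eq_lintegral_ofReal (μ := (volume : Measure (ι → ℝ)))
    (Integrable.fintype_prod hind)
    (Filter.Eventually.of_forall fun x => Finset.prod_nonneg fun i _ => hnn i _),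
    integral_fintype_prod_volume_eq_prod (fun i => (s i).indicator (gaussianPDFReal 0 1)),
    ENNReal.ofReal_prod_of_nonneg fun i _ => integral_nonneg (hnn i)]
  refine Finset.prod_congr rfl fun i _ => ?_
  rw [integral_indicator (hs i), gaussianReal_apply_eq_integral 0 one_ne_zero]

variable {ι : Type*} [Fintype ι] [DecidableEq ι]

/-- Change of variables for Gaussian densities: if `S` is a symmetric square root of `C`, then
`xᵀ x = (S x)ᵀ C⁻¹ (S x)`, and `|det S| = √(det C)` is the ratio of the normalizing constants. -/
lemma prod_gaussianPDFReal_eq_gaussianDensity_mulVec {S C : Matrix ι ι ℝ} (hS : Sᵀ = S)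
    (hSC : S * S = C) (hdet : S.det ≠ 0) (x : ι → ℝ) :
    ∏ i, gaussianPDFReal 0 1 (x i) = |S.det| * gaussianDensity 0 C (S *ᵥ x) := by
  have hquad : (S *ᵥ x) ⬝ᵥ (C⁻¹ *ᵥ (S *ᵥ x)) = ∑ i, x i ^ 2 := by
    have hu : IsUnit S.det := hdet.isUnit
    rw [← hSC, Matrix.mul_inv_rev, Matrix.mulVec_mulVec, Matrix.mul_assoc,
      Matrix.nonsing_inv_mul _ hu, Matrix.mul_one, Matrix.dotProduct_mulVec,
      ← Matrix.mulVec_transpose, Matrix.transpose_nonsing_inv, hS, Matrix.mulVec_mulVec,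
      Matrix.nonsing_inv_mul _ hu, Matrix.one_mulVec]
    simp [dotProduct, sq]
  have hsqrt : √((2 * Real.pi) ^ Fintype.card ι * C.det) =
      √(2 * Real.pi) ^ Fintype.card ι * |S.det| := by
    rw [← hSC, Matrix.det_mul, Real.sqrt_mul (by positivity), Real.sqrt_mul_self_eq_abs]
    congr 1
    rw [Real.sqrt_eq_iff_mul_self_eq (by positivity) (by positivity), ← mul_pow,
      Real.mul_self_sqrt (by positivity)]
  have habs : |S.det| ≠ 0 := abs_ne_zero.2 hdet
  simp only [gaussianDensity, gaussianPDFReal, sub_zero, hquad, hsqrt, NNReal.coe_one, mul_one]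
  rw [Finset.prod_mul_distrib, ← Real.exp_sum, Finset.prod_const, Finset.card_univ,
    ← Finset.sum_div, Finset.sum_neg_distrib, inv_pow]
  field_simp

@[fun_prop]
lemma continuous_gaussianDensity (μ : ι → ℝ) (C : Matrix ι ι ℝ) :
    Continuous (gaussianDensity μ C) := by
  unfold gaussianDensity
  fun_prop

lemma gaussianDensity_nonneg (μ : ι → ℝ) (C : Matrix ι ι ℝ) (x : ι → ℝ) :
    0 ≤ gaussianDensity μ C x := by
  unfold gaussianDensity
  positivity

lemma gaussianDensity_pos (μ : ι → ℝ) {C : Matrix ι ι ℝ} (hC : C.PosDef) (x : ι → ℝ) :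
    0 < gaussianDensity μ C x := by
  have := hC.det_pos
  unfold gaussianDensity
  positivity

open scoped MatrixOrder in
/-- For a positive definite `C`, `gaussianDensity 0 C` is the Lebesgue density of
`multivariateGaussian 0 C`, which is defined as the image of the standard Gaussian measure under
the square root of `C`. -/
lemma map_ofLp_multivariateGaussian {C : Matrix ι ι ℝ} (hC : C.PosDef) :
    (multivariateGaussian 0 C).map (WithLp.ofLp (p := 2)) =
      volume.withDensity (fun x => ENNReal.ofReal (gaussianDensity 0 C x)) := by
  set S : Matrix ι ι ℝ := CFC.sqrt C
  have hSC : S * S = C := CFC.sqrt_mul_sqrt_self C hC.posSemidef.nonneg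
  have hS : Sᵀ = S := by
    have := (CFC.sqrt_nonneg C).isSelfAdjoint
    simpa [IsSelfAdjoint, Matrix.star_eq_conjTranspose] using this
  have hdet : S.det ≠ 0 := by
    intro h0
    have := hC.det_pos
    rw [← hSC, Matrix.det_mul, h0] at this
    simp at this
  have hmeas : Measurable (fun x : ι → ℝ => S *ᵥ x) := by fun_prop
  have hmap : (multivariateGaussian 0 C).map (WithLp.ofLp (p := 2)) =
      (Measure.pi (fun _ : ι => gaussianReal 0 1)).map (fun x => S *ᵥ x) := by
    rw [multivariateGaussian, ← map_pi_eq_stdGaussian, Measure.map_map (by fun_prop) (by fun_prop),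
      Measure.map_map (by fun_prop) (by fun_prop)]
    congr 1
    ext x i
    simp [S]
  rw [hmap, pi_gaussianReal_eq_withDensity]
  ext s hs
  have hg : Measurable fun x => ENNReal.ofReal (gaussianDensity 0 C x) := by fun_prop
  rw [Measure.map_apply hmeas hs, withDensity_apply _ (hmeas hs), withDensity_apply _ hs]
  simp_rw [prod_gaussianPDFReal_eq_gaussianDensity_mulVec hS hSC hdet,
    ENNReal.ofReal_mul (abs_nonneg _)]
  rw [lintegral_const_mul _ (by fun_prop), ← setLIntegral_map hs hg hmeas]
  have hvol : (volume : Measure (ι → ℝ)).map (fun x => S *ᵥ x) =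
      ENNReal.ofReal |S.det⁻¹| • volume := by
    rw [← Real.map_matrix_volume_pi_eq_smul_volume_pi hdet]
    rfl
  rw [hvol, Measure.restrict_smul, lintegral_smul_measure, smul_eq_mul, ← mul_assoc,
    ← ENNReal.ofReal_mul (abs_nonneg _), ← abs_mul, mul_inv_cancel₀ hdet]
  simp

/-! ### Splitting off one coordinate -/

/-- The vector with entry `t` at position `n` whose remaining entries are those of `y`; the inverse
of `x ↦ (x n, truncVec n x)`. -/
def insertEntry {ι : Type*} [DecidableEq ι] (n : ι) (t : ℝ) (y : {j : ι // j ≠ n} → ℝ) : ι → ℝ :=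
  fun j => if h : j = n then t else y ⟨j, h⟩

lemma truncVec_insertEntry {ι : Type*} [DecidableEq ι] (n : ι) (t : ℝ) (y : {j : ι // j ≠ n} → ℝ) :
    truncVec n (insertEntry n t y) = y := by
  ext ⟨j, hj⟩
  simp [truncVec, insertEntry, hj]

@[simp]
lemma insertEntry_self {ι : Type*} [DecidableEq ι] (n : ι) (t : ℝ) (y : {j : ι // j ≠ n} → ℝ) :
    insertEntry n t y n = t := by
  simp [insertEntry]

lemma insertEntry_eq_add {ι : Type*} [DecidableEq ι] (n : ι) (t : ℝ) (y : {j : ι // j ≠ n} → ℝ) :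
    insertEntry n t y = t • Pi.single n 1 + insertEntry n 0 y := by
  ext j
  by_cases h : j = n
  · subst h; simp [insertEntry]
  · simp [insertEntry, h]

lemma measurable_insertEntry {ι : Type*} [DecidableEq ι] (n : ι) :
    Measurable (fun p : ({j : ι // j ≠ n} → ℝ) × ℝ => insertEntry n p.2 p.1) := by
  refine measurable_pi_lambda _ fun j => ?_
  by_cases h : j = n
  · simp only [insertEntry, h, dite_true]
    fun_prop
  · simp only [insertEntry, h, dite_false]
    fun_prop

/-- Splitting off one coordinate identifies Lebesgue measure on `ℝ^ι` with a product. The split-off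
coordinate is the second factor, so that Fubini's theorem integrates over it first. -/
lemma measurePreserving_insertEntry (n : ι) :
    MeasurePreserving (fun p : ({j : ι // j ≠ n} → ℝ) × ℝ => insertEntry n p.2 p.1)
      (volume.prod volume) volume := by
  refine ⟨measurable_insertEntry n, (Measure.pi_eq fun s hs => ?_).symm⟩
  have hpre : (fun p : ({j : ι // j ≠ n} → ℝ) × ℝ => insertEntry n p.2 p.1) ⁻¹'
      Set.univ.pi s = (Set.univ.pi fun j : {j : ι // j ≠ n} => s j) ×ˢ s n := by
    ext ⟨y, t⟩
    simp only [Set.mem_preimage, Set.mem_pi, Set.mem_univ, true_implies, Set.mem_prod]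
    constructor
    · intro h
      exact ⟨fun j => by simpa [insertEntry, j.2] using h j, by simpa using h n⟩
    · rintro ⟨h1, h2⟩ j
      by_cases hj : j = n
      · subst hj
        simpa using h2
      · simpa [insertEntry, hj] using h1 ⟨j, hj⟩
  rw [Measure.map_apply (measurable_insertEntry n) (MeasurableSet.univ_pi hs), hpre,
    Measure.prod_prod, volume_pi_pi, Fintype.prod_eq_mul_prod_subtype_ne _ n, mul_comm]

lemma measurableEmbedding_insertEntry {ι : Type*} [DecidableEq ι] (n : ι) :
    MeasurableEmbedding (fun p : ({j : ι // j ≠ n} → ℝ) × ℝ => insertEntry n p.2 p.1) := by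
  refine MeasurableEmbedding.of_measurable_inverse (g := fun x : ι → ℝ => (truncVec n x, x n))
    (measurable_insertEntry n) ?_ ?_ ?_
  · rw [(?_ : Set.range _ = Set.univ)]
    · exact MeasurableSet.univ
    · refine Set.range_eq_univ.2 fun x => ⟨(truncVec n x, x n), ?_⟩
      ext j
      by_cases h : j = n
      · subst h; simp
      · simp [insertEntry, truncVec, h]
  · unfold truncVec
    fun_prop
  · rintro ⟨y, t⟩
    simp [truncVec_insertEntry]

/-! ### The Gaussian density on a coordinate hyperplane -/

lemma adjugate_diag_eq_det_truncMat (A : Matrix ι ι ℝ) (n : ι) :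
    A.adjugate n n = (truncMat n A).det := by
  rw [Matrix.adjugate_apply, Matrix.twoBlockTriangular_det' _ (fun j => j = n)]
  · have h1 : (toSquareBlockProp (A.updateRow n (Pi.single n 1)) fun j => j = n) = 1 := by
      ext ⟨i, hi⟩ ⟨j, hj⟩
      subst hi
      subst hj
      simp [toSquareBlockProp]
    have h2 : (toSquareBlockProp (A.updateRow n (Pi.single n 1)) fun j => ¬ j = n) =
        truncMat n A := by
      ext ⟨i, hi⟩ ⟨j, hj⟩
      simp [toSquareBlockProp, truncMat, hi]
    rw [h1, h2]
    simp
  · rintro i rfl j hj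
    simp [hj]

/-- By Cramer's rule, `C n n = (C⁻¹)⁻¹ n n` is the minor of `C⁻¹` at `n` divided by `det C⁻¹`. -/
lemma det_truncMat_inv {C : Matrix ι ι ℝ} (hC : C.PosDef) (n : ι) :
    (truncMat n C⁻¹).det = C n n / C.det := by
  have hdet := hC.det_pos.ne'
  have h := congrFun₂ (Matrix.nonsing_inv_nonsing_inv C hdet.isUnit) n n
  rw [Matrix.inv_def C⁻¹, Matrix.smul_apply, adjugate_diag_eq_det_truncMat,
    Matrix.det_nonsing_inv, Ring.inverse_eq_inv', inv_inv, smul_eq_mul] at h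
  rw [← h]
  field_simp

lemma sum_mul_insertEntry_zero (n : ι) (y : {j : ι // j ≠ n} → ℝ) (a : ι → ℝ) :
    ∑ j, a j * insertEntry n 0 y j = ∑ j : {j : ι // j ≠ n}, a j * y j := by
  rw [Fintype.sum_eq_add_sum_subtype_ne _ n, insertEntry_self, mul_zero, zero_add]
  exact Finset.sum_congr rfl fun j _ => by simp [insertEntry, j.2]

lemma dotProduct_mulVec_insertEntry_zero (A : Matrix ι ι ℝ) (n : ι)
    (y : {j : ι // j ≠ n} → ℝ) :
    insertEntry n 0 y ⬝ᵥ (A *ᵥ insertEntry n 0 y) = y ⬝ᵥ (truncMat n A *ᵥ y) := by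
  rw [dotProduct_comm]
  simp only [dotProduct, mulVec, sum_mul_insertEntry_zero]
  exact Finset.sum_congr rfl fun j _ => by simp [truncMat, mul_comm]

/-- On the hyperplane `x n = 0` the density factorizes: the quadratic form restricts to the one of
the truncated precision matrix, and `det_truncMat_inv` matches the normalizing constants. -/
lemma gaussianDensity_insertEntry_zero {C : Matrix ι ι ℝ} (hC : C.PosDef) (n : ι)
    (y : {j : ι // j ≠ n} → ℝ) :
    gaussianDensity 0 C (insertEntry n 0 y) =
      gaussianPDFReal 0 (C n n).toNNReal 0 * truncGaussianDensity n C y := by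
  have hCn : 0 < C n n := hC.diag_pos
  have hCdet := hC.det_pos
  have hu : IsUnit (truncMat n C⁻¹).det := by
    rw [det_truncMat_inv hC]
    exact (div_pos hCn hCdet).ne'.isUnit
  have hcard : Fintype.card ι = Fintype.card {j : ι // j ≠ n} + 1 := by
    have := Fintype.card_pos_iff.2 ⟨n⟩
    simp only [ne_eq, Fintype.card_subtype_compl, Fintype.card_unique]
    omega
  simp only [truncGaussianDensity, gaussianDensity, gaussianPDFReal, sub_zero,
    dotProduct_mulVec_insertEntry_zero, Matrix.nonsing_inv_nonsing_inv _ hu,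
    Real.coe_toNNReal _ hCn.le]
  rw [Matrix.det_nonsing_inv, Ring.inverse_eq_inv', det_truncMat_inv hC, inv_div, ← mul_assoc]
  congr 1
  rw [zero_pow two_ne_zero, neg_zero, zero_div, Real.exp_zero, mul_one, ← mul_inv,
    ← Real.sqrt_mul (by positivity), hcard, pow_succ]
  congr 2
  field_simp

/-! ### Orthants -/

lemma sign_eq_iff_of_eq_one_or {ρ : ℝ} (hρ : ρ = 1 ∨ ρ = -1) (t : ℝ) :
    Real.sign t = ρ ↔ 0 < ρ * t := by
  rcases hρ with rfl | rfl <;> rcases lt_trichotomy t 0 with h | h | h <;>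
    simp [Real.sign_of_neg, Real.sign_of_pos, h, Real.sign_zero] <;> norm_num <;> linarith

lemma measurable_realSign : Measurable Real.sign := by
  unfold Real.sign
  exact Measurable.ite measurableSet_Iio measurable_const
    (Measurable.ite measurableSet_Ioi measurable_const measurable_const)

lemma mem_quantCell_iff {ι : Type*} {r : ι → ℝ} (hr : ∀ j, r j = 1 ∨ r j = -1) (x : ι → ℝ) :
    x ∈ quantCell r ↔ ∀ j, 0 < r j * x j := by
  simp only [quantCell, quantize, Set.mem_ofPred_eq, funext_iff]
  exact forall_congr' fun j => sign_eq_iff_of_eq_one_or (hr j) (x j)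

lemma measurable_quantize {ι : Type*} : Measurable (quantize : (ι → ℝ) → ι → ℝ) :=
  measurable_pi_lambda _ fun j => measurable_realSign.comp (measurable_pi_apply j)

lemma measurableSet_quantCell {ι : Type*} [Countable ι] (r : ι → ℝ) :
    MeasurableSet (quantCell r) :=
  measurable_quantize (measurableSet_singleton r)

lemma volume_quantCell_pos {ι : Type*} [Fintype ι] {r : ι → ℝ} (hr : ∀ j, r j = 1 ∨ r j = -1) :
    0 < volume (quantCell r) := by
  have hset : quantCell r = {x | ∀ j, 0 < r j * x j} := Set.ext (mem_quantCell_iff hr)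
  have hopen : IsOpen (quantCell r) := by
    rw [hset, Set.ofPred_forall]
    exact isOpen_iInter_of_finite fun j => isOpen_lt continuous_const (by fun_prop)
  refine hopen.measure_pos volume ⟨r, (mem_quantCell_iff hr r).2 fun j => ?_⟩
  rcases hr j with h | h <;> simp [h]

/-! ### The divergence theorem on an orthant -/

/-- The fundamental theorem of calculus on the half-line where `t` has the sign `ρ`. Integrability
of `f` and `f'` makes `f` vanish at infinity, so only the boundary term at `0` remains. -/
lemma integral_signed_halfLine_of_hasDerivAt {ρ : ℝ} (hρ : ρ = 1 ∨ ρ = -1) {f f' : ℝ → ℝ}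
    (hderiv : ∀ t, HasDerivAt f (f' t) t) (hf : Integrable f) (hf' : Integrable f') :
    ∫ t in {t | 0 < ρ * t}, f' t = -ρ * f 0 := by
  rcases hρ with rfl | rfl
  · have hset : {t : ℝ | 0 < 1 * t} = Set.Ioi 0 := by ext t; simp
    rw [hset, integral_Ioi_of_hasDerivAt_of_tendsto' (fun t _ => hderiv t) hf'.integrableOn
      (tendsto_zero_of_hasDerivAt_of_integrableOn_Ioi (a := 0) (fun t _ => hderiv t)
        hf'.integrableOn hf.integrableOn)]
    ring
  · have hset : {t : ℝ | 0 < -1 * t} = Set.Iio 0 := by ext t; simp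
    rw [hset, ← integral_Iic_eq_integral_Iio,
      integral_Iic_of_hasDerivAt_of_tendsto' (fun t _ => hderiv t) hf'.integrableOn
      (tendsto_zero_of_hasDerivAt_of_integrableOn_Iic (a := 0) (fun t _ => hderiv t)
        hf'.integrableOn hf.integrableOn)]
    ring

/-- The divergence theorem for the `n`-th partial derivative `f'` of `f` on an orthant: of the
boundary, only the face `x n = 0`, whose outward unit normal is `-r n` times the `n`-th unit vector,
contributes. -/
lemma setIntegral_quantCell_of_hasDerivAt {r : ι → ℝ} (hr : ∀ j, r j = 1 ∨ r j = -1) (n : ι)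
    {f f' : (ι → ℝ) → ℝ} (hf : Integrable f) (hf' : Integrable f')
    (hderiv : ∀ (y : {j : ι // j ≠ n} → ℝ) (t : ℝ),
      HasDerivAt (fun s => f (insertEntry n s y)) (f' (insertEntry n t y)) t) :
    ∫ x in quantCell r, f' x =
      -r n * ∫ y in quantCell (truncVec n r), f (insertEntry n 0 y) := by
  have hmp := measurePreserving_insertEntry n
  have hemb := measurableEmbedding_insertEntry n
  have hpre : (fun p : ({j : ι // j ≠ n} → ℝ) × ℝ => insertEntry n p.2 p.1) ⁻¹' quantCell r =
      quantCell (truncVec n r) ×ˢ {t | 0 < r n * t} := by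
    ext ⟨y, t⟩
    simp only [Set.mem_preimage, Set.mem_prod, mem_quantCell_iff hr,
      mem_quantCell_iff (r := truncVec n r) fun j => hr j, Set.mem_ofPred_eq, truncVec]
    constructor
    · intro h
      exact ⟨fun j => by simpa [insertEntry, j.2] using h j, by simpa using h n⟩
    · rintro ⟨h1, h2⟩ j
      by_cases hj : j = n
      · subst hj
        simpa using h2
      · simpa [insertEntry, hj] using h1 ⟨j, hj⟩
  have hfp := (hmp.integrable_comp_emb hemb).2 hf
  have hfp' := (hmp.integrable_comp_emb hemb).2 hf'
  rw [← hmp.setIntegral_preimage_emb hemb, hpre,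
    setIntegral_prod (fun p => f' (insertEntry n p.2 p.1)) hfp'.integrableOn, ← integral_const_mul]
  refine setIntegral_congr_ae (measurableSet_quantCell _) ?_
  filter_upwards [hfp.prod_right_ae, hfp'.prod_right_ae] with y hy hy' _
  exact integral_signed_halfLine_of_hasDerivAt (hr n) (hderiv y) hy hy'

/-! ### The mean of a Gaussian over an orthant -/

/-- The `n`-th partial derivative of the centred Gaussian density `p` is `-(C⁻¹ x)ₙ p(x)`. -/
lemma hasDerivAt_gaussianDensity_insertEntry {C : Matrix ι ι ℝ} (hC : C.PosDef) (n : ι)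
    (y : {j : ι // j ≠ n} → ℝ) (t : ℝ) :
    HasDerivAt (fun s => gaussianDensity 0 C (insertEntry n s y))
      (-((C⁻¹ *ᵥ insertEntry n t y) n * gaussianDensity 0 C (insertEntry n t y))) t := by
  set v := insertEntry n 0 y
  have hsymm : (C⁻¹)ᵀ = C⁻¹ := by
    simpa using hC.inv.isHermitian.eq
  have hlin : ∀ s, (C⁻¹ *ᵥ insertEntry n s y) n = s * C⁻¹ n n + (C⁻¹ *ᵥ v) n := fun s => by
    rw [insertEntry_eq_add, mulVec_add, mulVec_smul]
    simp [v]
  have hquad : ∀ s, insertEntry n s y ⬝ᵥ (C⁻¹ *ᵥ insertEntry n s y) =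
      s ^ 2 * C⁻¹ n n + 2 * s * (C⁻¹ *ᵥ v) n + v ⬝ᵥ (C⁻¹ *ᵥ v) := fun s => by
    have hcross : v ⬝ᵥ (C⁻¹ *ᵥ Pi.single n 1) = (C⁻¹ *ᵥ v) n := by
      rw [dotProduct_mulVec, ← mulVec_transpose, hsymm]
      simp
    rw [insertEntry_eq_add, mulVec_add, mulVec_smul, add_dotProduct, dotProduct_add,
      dotProduct_add, smul_dotProduct, smul_dotProduct, dotProduct_smul, dotProduct_smul, hcross]
    simp [v]
    ring
  have hexp : HasDerivAt (fun s => -(insertEntry n s y ⬝ᵥ (C⁻¹ *ᵥ insertEntry n s y)) / 2)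
      (-(C⁻¹ *ᵥ insertEntry n t y) n) t := by
    simp only [hquad, hlin]
    have h := (((hasDerivAt_pow 2 t).mul_const (C⁻¹ n n)).add
      (((hasDerivAt_id' t).const_mul 2).mul_const ((C⁻¹ *ᵥ v) n))).add_const (v ⬝ᵥ (C⁻¹ *ᵥ v))
    exact (h.neg.div_const 2).congr_deriv (by push_cast; ring)
  simp only [gaussianDensity, sub_zero]
  exact (hexp.exp.const_mul _).congr_deriv (by ring)

/-- Integrability against the density follows from integrability under the Gaussian measure, whose
moments Mathlib provides. -/
lemma integrable_mul_gaussianDensity_of_integrable_multivariateGaussian {C : Matrix ι ι ℝ}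
    (hC : C.PosDef) {g : (ι → ℝ) → ℝ} (hg : Measurable g)
    (hint : Integrable (fun x : EuclideanSpace ℝ ι => g x.ofLp) (multivariateGaussian 0 C)) :
    Integrable (fun x => g x * gaussianDensity 0 C x) := by
  have h : Integrable g ((multivariateGaussian 0 C).map (WithLp.ofLp (p := 2))) :=
    (integrable_map_measure hg.aestronglyMeasurable (by fun_prop)).2 hint
  rw [map_ofLp_multivariateGaussian hC, integrable_withDensity_iff_integrable_smul' (by fun_prop)
    (by simp)] at h
  refine h.congr (Filter.Eventually.of_forall fun x => ?_)
  simp [ENNReal.toReal_ofReal (gaussianDensity_nonneg 0 C x), mul_comm]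

lemma integrable_gaussianDensity {C : Matrix ι ι ℝ} (hC : C.PosDef) :
    Integrable (gaussianDensity 0 C) := by
  simpa using integrable_mul_gaussianDensity_of_integrable_multivariateGaussian hC
    (g := fun _ => 1) measurable_const (integrable_const _)

lemma integrable_apply_multivariateGaussian (C : Matrix ι ι ℝ) (j : ι) :
    Integrable (fun x : EuclideanSpace ℝ ι => x j) (multivariateGaussian 0 C) :=
  (EuclideanSpace.proj (𝕜 := ℝ) j).integrable_comp IsGaussian.integrable_id

lemma integrable_apply_mul_gaussianDensity {C : Matrix ι ι ℝ} (hC : C.PosDef) (j : ι) :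
    Integrable (fun x => x j * gaussianDensity 0 C x) :=
  integrable_mul_gaussianDensity_of_integrable_multivariateGaussian hC (measurable_pi_apply j)
    (integrable_apply_multivariateGaussian C j)

lemma integrable_mulVec_apply_mul_gaussianDensity {C : Matrix ι ι ℝ} (hC : C.PosDef)
    (A : Matrix ι ι ℝ) (n : ι) :
    Integrable (fun x => (A *ᵥ x) n * gaussianDensity 0 C x) := by
  have h := integrable_finsetSum Finset.univ fun j _ =>
    (integrable_apply_mul_gaussianDensity hC j).const_mul (A n j)
  refine h.congr (Filter.Eventually.of_forall fun x => ?_)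
  simp [mulVec, dotProduct, Finset.sum_mul, mul_assoc]

/-- The unnormalized conditional mean: writing `x = C (C⁻¹ x)` turns `x i` times the density into a
linear combination of its partial derivatives, to which the divergence theorem applies. -/
theorem setIntegral_quantCell_apply_mul_gaussianDensity {C : Matrix ι ι ℝ} (hC : C.PosDef)
    {r : ι → ℝ} (hr : ∀ j, r j = 1 ∨ r j = -1) (i : ι) :
    ∫ x in quantCell r, x i * gaussianDensity 0 C x = orthantSum C r i := by
  have hsplit : ∀ x : ι → ℝ, x i * gaussianDensity 0 C x =
      ∑ n, C i n * ((C⁻¹ *ᵥ x) n * gaussianDensity 0 C x) := fun x => by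
    have h : x i = ∑ n, C i n * (C⁻¹ *ᵥ x) n := by
      change _ = (C *ᵥ (C⁻¹ *ᵥ x)) i
      rw [mulVec_mulVec, mul_nonsing_inv _ hC.det_pos.ne'.isUnit, one_mulVec]
    simp_rw [← mul_assoc]
    rw [← Finset.sum_mul, ← h]
  simp_rw [hsplit]
  rw [integral_finsetSum _ fun n _ =>
    ((integrable_mulVec_apply_mul_gaussianDensity hC C⁻¹ n).const_mul _).integrableOn]
  refine Finset.sum_congr rfl fun n _ => ?_
  have hdiv := setIntegral_quantCell_of_hasDerivAt hr n (integrable_gaussianDensity hC)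
    (integrable_mulVec_apply_mul_gaussianDensity hC C⁻¹ n).neg
    (hasDerivAt_gaussianDensity_insertEntry hC n)
  simp only [Pi.neg_apply, integral_neg, gaussianDensity_insertEntry_zero hC,
    integral_const_mul, neg_mul, neg_inj] at hdiv
  rw [integral_const_mul, hdiv]
  ring

/-! ### Conditioning on the fibres of a random variable -/

/-- At every point of a fibre of `X` of positive probability, the conditional expectation given
`X` equals the average of `f` over that fibre: being measurable with respect to `X`, it is constant
on the fibre. -/
lemma condExp_comap_eq_average {Ω β E : Type*} [MeasurableSpace Ω] [MeasurableSpace β]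
    [MeasurableSingletonClass β] [NormedAddCommGroup E] [NormedSpace ℝ E] [CompleteSpace E]
    {P : Measure Ω} [IsFiniteMeasure P] {X : Ω → β} (hX : Measurable X) {f : Ω → E}
    (hf : Integrable f P) {ω : Ω} (hω : P (X ⁻¹' {X ω}) ≠ 0) :
    (P[f | MeasurableSpace.comap X inferInstance]) ω =
      ∫ ω', f ω' ∂(ProbabilityTheory.cond P (X ⁻¹' {X ω})) := by
  have hset := setIntegral_condExp hX.comap_le hf ⟨{X ω}, measurableSet_singleton _, rfl⟩
  have hconst : ∫ ω' in X ⁻¹' {X ω}, (P[f | MeasurableSpace.comap X inferInstance]) ω' ∂P =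
      ∫ _ in X ⁻¹' {X ω}, (P[f | MeasurableSpace.comap X inferInstance]) ω ∂P :=
    setIntegral_congr_fun (hX (measurableSet_singleton _)) fun ω' hω' =>
      stronglyMeasurable_condExp.factorsThrough hω'
  rw [hconst, setIntegral_const] at hset
  rw [ProbabilityTheory.cond, integral_smul_measure, ← hset, smul_smul, ENNReal.toReal_inv,
    measureReal_def, inv_mul_cancel₀ (ENNReal.toReal_ne_zero.2 ⟨hω, measure_ne_top _ _⟩), one_smul]

/-! ### The law of the observation and its conditional means -/

lemma measurable_observation {Ω : Type*} [MeasurableSpace Ω] {N : ℕ}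
    {h : Ω → EuclideanSpace ℝ (Fin N)} (hmeas : Measurable h) : Measurable (observation h) :=
  measurable_quantize.comp (by fun_prop : Measurable fun ω j => h ω j)

variable {Ω : Type*} [MeasurableSpace Ω] {P : Measure Ω} {N : ℕ}
  {C : Matrix (Fin N) (Fin N) ℝ} {h : Ω → EuclideanSpace ℝ (Fin N)}

lemma map_coords_eq_withDensity (hC : C.PosDef) (hmeas : Measurable h)
    (hlaw : P.map h = multivariateGaussian 0 C) :
    P.map (fun ω => (h ω).ofLp) =
      volume.withDensity (fun x => ENNReal.ofReal (gaussianDensity 0 C x)) := by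
  rw [← map_ofLp_multivariateGaussian hC, ← hlaw, Measure.map_map (by fun_prop) hmeas]
  rfl

lemma measure_observation_preimage (hC : C.PosDef) (hmeas : Measurable h)
    (hlaw : P.map h = multivariateGaussian 0 C) (r : Fin N → ℝ) :
    P (observation h ⁻¹' {r}) =
      ∫⁻ x in quantCell r, ENNReal.ofReal (gaussianDensity 0 C x) := by
  rw [← withDensity_apply _ (measurableSet_quantCell r), ← map_coords_eq_withDensity hC hmeas hlaw,
    Measure.map_apply (by fun_prop) (measurableSet_quantCell r)]
  rfl

lemma obsPMF_eq_setIntegral (hC : C.PosDef) (hmeas : Measurable h)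
    (hlaw : P.map h = multivariateGaussian 0 C) (r : Fin N → ℝ) :
    obsPMF P h r = ∫ x in quantCell r, gaussianDensity 0 C x := by
  rw [obsPMF, measureReal_def, measure_observation_preimage hC hmeas hlaw,
    integral_eq_lintegral_of_nonneg_ae
      (Filter.Eventually.of_forall (gaussianDensity_nonneg 0 C)) (by fun_prop)]

lemma measure_observation_preimage_ne_zero (hC : C.PosDef) (hmeas : Measurable h)
    (hlaw : P.map h = multivariateGaussian 0 C) {r : Fin N → ℝ}
    (hr : ∀ j, r j = 1 ∨ r j = -1) :
    P (observation h ⁻¹' {r}) ≠ 0 := by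
  rw [measure_observation_preimage hC hmeas hlaw]
  -- The density is positive everywhere, and the cell has positive volume.
  exact (setLIntegral_pos_iff (by fun_prop)).2 (by
    have hsupp : Function.support (fun x => ENNReal.ofReal (gaussianDensity 0 C x)) = Set.univ :=
      Set.eq_univ_of_forall fun x => by simp [gaussianDensity_pos 0 hC x]
    rw [hsupp, Set.univ_inter]
    exact volume_quantCell_pos hr) |>.ne'

lemma integrable_of_map_eq_multivariateGaussian (hmeas : Measurable h)
    (hlaw : P.map h = multivariateGaussian 0 C) : Integrable h P := by
  have hint : Integrable id (P.map h) := hlaw ▸ IsGaussian.integrable_id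
  exact (integrable_map_measure (by fun_prop) hmeas.aemeasurable).1 hint

lemma conditionalMean_eq_orthantSum [IsFiniteMeasure P] (hC : C.PosDef) (hmeas : Measurable h)
    (hlaw : P.map h = multivariateGaussian 0 C) {r : Fin N → ℝ}
    (hr : ∀ j, r j = 1 ∨ r j = -1) (i : Fin N) :
    conditionalMean P h r i = (1 / obsPMF P h r) * orthantSum C r i := by
  have hint := integrable_of_map_eq_multivariateGaussian hmeas hlaw
  have hcell : ∫ ω in observation h ⁻¹' {r}, h ω i ∂P =
      ∫ x in quantCell r, x i * gaussianDensity 0 C x := by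
    have hmap := setIntegral_map (μ := P) (g := fun ω => (h ω).ofLp) (f := fun x => x i)
      (measurableSet_quantCell r) (measurable_pi_apply i).aestronglyMeasurable (by fun_prop)
    rw [map_coords_eq_withDensity hC hmeas hlaw,
      setIntegral_withDensity_eq_setIntegral_toReal_smul (by fun_prop) (by simp) _
        (measurableSet_quantCell r)] at hmap
    refine hmap.symm.trans (integral_congr_ae (Filter.Eventually.of_forall fun x => ?_))
    simp [ENNReal.toReal_ofReal (gaussianDensity_nonneg 0 C x), mul_comm]
  have hcoord : (∫ ω in observation h ⁻¹' {r}, h ω ∂P) i =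
      ∫ ω in observation h ⁻¹' {r}, h ω i ∂P :=
    ((EuclideanSpace.proj (𝕜 := ℝ) i).integral_comp_comm hint.integrableOn).symm
  rw [conditionalMean, ProbabilityTheory.cond, integral_smul_measure, PiLp.smul_apply, hcoord,
    hcell, setIntegral_quantCell_apply_mul_gaussianDensity hC hr, ENNReal.toReal_inv, smul_eq_mul,
    one_div]
  rfl

lemma ae_observation_eq_one_or (hC : C.PosDef) (hmeas : Measurable h)
    (hlaw : P.map h = multivariateGaussian 0 C) :
    ∀ᵐ ω ∂P, ∀ j, observation h ω j = 1 ∨ observation h ω j = -1 := by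
  refine ae_all_iff.2 fun j => ?_
  have hne : ∀ᵐ x ∂(P.map fun ω => (h ω).ofLp), x j ≠ 0 := by
    rw [map_coords_eq_withDensity hC hmeas hlaw]
    exact (withDensity_absolutelyContinuous _ _).ae_le (Measure.ae_eval_ne _ j 0)
  filter_upwards [ae_of_ae_map (by fun_prop) hne] with ω hω
  exact (Real.sign_apply_eq_of_ne_zero _ hω).symm

end OneBit

theorem theorem1 {Ω : Type*} [MeasurableSpace Ω] (P : Measure Ω) [IsProbabilityMeasure P]
    {N : ℕ} (C : Matrix (Fin N) (Fin N) ℝ) (hC : C.PosDef)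
    (h : Ω → EuclideanSpace ℝ (Fin N)) (hmeas : Measurable h)
    (hlaw : P.map h = multivariateGaussian 0 C) :
    -- `h` is integrable, so that its conditional mean is meaningful
    Integrable h P ∧
    -- for every sign vector `r`: its probability, a Gaussian orthant integral, and the
    -- conditional mean given the value `r`
    (∀ r : Fin N → ℝ, (∀ j, r j = 1 ∨ r j = -1) →
      0 < OneBit.obsPMF P h r ∧
      OneBit.obsPMF P h r = ∫ x in OneBit.quantCell r, OneBit.gaussianDensity 0 C x ∧
      ∀ i, OneBit.conditionalMean P h r i =
        (1 / OneBit.obsPMF P h r) * OneBit.orthantSum C r i) ∧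
    -- almost surely the observation is a sign vector, and the conditional expectation given
    -- the observation is the same expression, evaluated at the observation
    (∀ᵐ ω ∂P, (∀ j, OneBit.observation h ω j = 1 ∨ OneBit.observation h ω j = -1) ∧
      ∀ i, (P[h | MeasurableSpace.comap (OneBit.observation h) inferInstance]) ω i =
        (1 / OneBit.obsPMF P h (OneBit.observation h ω)) *
          OneBit.orthantSum C (OneBit.observation h ω) i) := by
  have hae := OneBit.ae_observation_eq_one_or hC hmeas hlaw
  refine ⟨OneBit.integrable_of_map_eq_multivariateGaussian hmeas hlaw, fun r hr => ⟨?_, ?_, ?_⟩, ?_⟩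
  · exact ENNReal.toReal_pos (OneBit.measure_observation_preimage_ne_zero hC hmeas hlaw hr)
      (measure_ne_top _ _)
  · exact OneBit.obsPMF_eq_setIntegral hC hmeas hlaw r
  · exact OneBit.conditionalMean_eq_orthantSum hC hmeas hlaw hr
  · filter_upwards [hae] with ω hω
    refine ⟨hω, fun i => ?_⟩
    rw [OneBit.condExp_comap_eq_average (OneBit.measurable_observation hmeas)
      (OneBit.integrable_of_map_eq_multivariateGaussian hmeas hlaw)
      (OneBit.measure_observation_preimage_ne_zero hC hmeas hlaw hω)]
    exact OneBit.conditionalMean_eq_orthantSum hC hmeas hlaw hω i
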